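/- All digraphs are finite. A digraph is planar if its underlying undirected graph can be drawn in the plane without crossings, and its digirth is the length of a shortest directed cycle (loops having length $1$ and pairs of antiparallel arcs having length $2$). For a real number $p \ge 1$, an acyclic $p$-colouring of a digraph $D$ is a map $c : V(D) \to \mathbb{R}/p\mathbb{Z}$ such that for every $a \in \mathbb{R}$ the set of vertices whose colour lies in the image of $(a,a+1)$ in $\mathbb{R}/p\mathbb{Z}$ (an open interval of length $1$ on the circle of perimeter $p$) induces an acyclic subdigraph of $D$, i.e. one without directed cycles. The star dichromatic number of $D$ is $$\vec{\chi}^\ast(D) = \inf\{p \ge 1 \mid D \text{ admits an acyclic } p\text{-colouring}\}.$$ Theorem. For every integer $g \ge 3$ and every real $\varepsilon > 0$ there exists a planar digraph $D$ of digirth $g$ with $$\vec{\chi}^\ast(D) \in \left[\frac{g-1}{g-2} - \varepsilon,\ \frac{g-1}{g-2}\right].$$ -/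

import Mathlib

/-- A simple graph is planar if it can be drawn in the plane: the vertices are distinct points and
every edge is a simple arc joining its two end vertices, such that an arc passes through no vertex
other than its ends and two different arcs meet at most in common ends. -/
def SimpleGraph.IsPlanar {V : Type*} (G : SimpleGraph V) : Prop :=
  ∃ (pos : V → EuclideanSpace ℝ (Fin 2))
    (arc : G.edgeSet → C(unitInterval, EuclideanSpace ℝ (Fin 2))),
    Function.Injective pos ∧
    (∀ e : G.edgeSet, Function.Injective (arc e)) ∧
    (∀ e : G.edgeSet, ∃ u v : V, (e : Sym2 V) = s(u, v) ∧ arc e 0 = pos u ∧ arc e 1 = pos v) ∧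
    (∀ e : G.edgeSet, ∀ v : V, pos v ∈ Set.range (arc e) → v ∈ (e : Sym2 V)) ∧
    (∀ e f : G.edgeSet, e ≠ f → ∀ x ∈ Set.range (arc e) ∩ Set.range (arc f),
      ∃ v : V, v ∈ (e : Sym2 V) ∧ v ∈ (f : Sym2 V) ∧ x = pos v)

namespace Digraph

/-- A digraph is planar if its underlying undirected graph is. (Loops and the multiplicity of
edges do not affect planarity.) -/
def IsPlanar {V : Type*} (D : Digraph V) : Prop :=
  D.toSimpleGraphInclusive.IsPlanar

/-- `c` is a directed cycle of length `n ≥ 1` in `D`: its `n` vertices are distinct, and each is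
followed by an arc to the (cyclically) next one. A loop is a cycle of length `1`, a pair of
antiparallel arcs is a cycle of length `2`. -/
def IsDirectedCycle {V : Type*} (D : Digraph V) (n : ℕ) (c : ZMod n → V) : Prop :=
  1 ≤ n ∧ Function.Injective c ∧ ∀ i, D.Adj (c i) (c (i + 1))

/-- The digirth: the length of a shortest directed cycle (`⊤` if there is none). -/
noncomputable def digirth {V : Type*} (D : Digraph V) : ℕ∞ :=
  ⨅ n ∈ {n : ℕ | ∃ c, D.IsDirectedCycle n c}, (n : ℕ∞)

/-- The subdigraph of `D` induced by the vertex set `S` is acyclic. -/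
def IsAcyclicOn {V : Type*} (D : Digraph V) (S : Set V) : Prop :=
  ¬ ∃ (n : ℕ) (c : ZMod n → V), D.IsDirectedCycle n c ∧ ∀ i, c i ∈ S

/-- An acyclic `p`-colouring (for `p ≥ 1`): colours are points of the circle `ℝ / pℤ` of
perimeter `p`, and for every open interval of length `1` on that circle, the vertices with
colours in it induce an acyclic subdigraph. -/
def IsAcyclicColouring {V : Type*} (D : Digraph V) (p : ℝ) (c : V → AddCircle p) : Prop :=
  ∀ a : ℝ, D.IsAcyclicOn (c ⁻¹' ((fun t : ℝ => (t : AddCircle p)) '' Set.Ioo a (a + 1)))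

/-- The star dichromatic number: the infimum of all real `p ≥ 1` for which `D` has an acyclic
`p`-colouring. It is taken in the extended reals, so that it is `⊤` if there is no such `p`. -/
noncomputable def starDichromaticNumber {V : Type*} (D : Digraph V) : EReal :=
  ⨅ p ∈ {p : ℝ | 1 ≤ p ∧ ∃ c : V → AddCircle p, D.IsAcyclicColouring p c}, (p : EReal)

end Digraph

/-! Write `g = h + 3`. In `cycleTower N h` the path of each level above the lowest is closed to a
directed `g`-cycle by either end of the level below. Conversely, the highest level met by a directed
cycle lies entirely on it, together with a vertex of another level. Hence the digirth is `g`, and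
colouring every level by `h + 2` equally spaced points of the circle of perimeter `(h + 2) / (h + 1)
= (g - 1) / (g - 2)` is acyclic.

For the lower bound, attach to each vertex the closed arc of length `p - 1` starting at its colour.
In an acyclic `p`-colouring the arcs along any directed cycle cover the circle. So whatever the arcs
of level `k + 1` miss lies in both end arcs of level `k`, which must therefore overlap. The union of
the two end arcs then shrinks by at least `1 - (h + 1) * (p - 1)` with each level down. It starts at
most `2 * (p - 1)` and stays nonnegative, so for large `N` the number `p` cannot lie below `1 + 1 /
(h + 1)` by `ε`. -/

/-! ### Planarity from a two-page book embedding -/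

/-- The point of the parabola through `(a, 0)` and `(b, 0)` with leading coefficient `-s`, at
parameter `t`. -/
noncomputable def parabolaPoint (s a b t : ℝ) : EuclideanSpace ℝ (Fin 2) :=
  !₂[a + t * (b - a), s * (t * (b - a) * ((1 - t) * (b - a)))]

@[simp] theorem parabolaPoint_zero (s a b : ℝ) : parabolaPoint s a b 0 = !₂[a, 0] := by
  simp [parabolaPoint]

@[simp] theorem parabolaPoint_one (s a b : ℝ) : parabolaPoint s a b 1 = !₂[b, 0] := by
  simp [parabolaPoint]

theorem euclidean_pair_inj {a b c d : ℝ} :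
    (!₂[a, b] : EuclideanSpace ℝ (Fin 2)) = !₂[c, d] ↔ a = c ∧ b = d := by
  constructor
  · intro h
    have h0 := congrArg (fun v : EuclideanSpace ℝ (Fin 2) => v 0) h
    have h1 := congrArg (fun v : EuclideanSpace ℝ (Fin 2) => v 1) h
    exact ⟨by simpa using h0, by simpa using h1⟩
  · rintro ⟨rfl, rfl⟩; rfl

theorem continuous_parabolaPoint (s a b : ℝ) : Continuous (parabolaPoint s a b) := by
  unfold parabolaPoint
  refine (PiLp.continuous_toLp 2 _).comp ?_
  refine continuous_pi fun i => ?_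
  fin_cases i <;> simp <;> fun_prop

/-- Two nested parabolas, or two over intervals with disjoint interiors, meet at most in a common
end: the algebra. -/
theorem parabola_meet {a b c d x : ℝ} (hx : x ∈ Set.Icc a b) (hx' : x ∈ Set.Icc c d)
    (hne : ¬(a = c ∧ b = d)) (h1 : ¬(a < c ∧ c < b ∧ b < d)) (h2 : ¬(c < a ∧ a < d ∧ d < b))
    (hy : (x - a) * (b - x) = (x - c) * (d - x)) :
    (x = a ∨ x = b) ∧ (x = c ∨ x = d) := by
  obtain ⟨ha, hb⟩ := hx
  obtain ⟨hc, hd⟩ := hx'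
  have key : ∀ {a b c d : ℝ}, a ≤ x → x ≤ b → c ≤ x → x ≤ d → ¬(a = c ∧ b = d) → a ≤ c → d ≤ b →
      (x - a) * (b - x) = (x - c) * (d - x) → (x = a ∨ x = b) ∧ (x = c ∨ x = d) := by
    intro a b c d ha hb hc hd hne hac hdb hy
    -- With equal leading coefficients the height difference is linear in `x`; for nested intervals
    -- it splits into two nonnegative terms.
    have e : (x - a) * (b - d) + (c - a) * (d - x) = 0 := by linarith
    have e1 : 0 ≤ (x - a) * (b - d) := mul_nonneg (by linarith) (by linarith)
    have e2 : 0 ≤ (c - a) * (d - x) := mul_nonneg (by linarith) (by linarith)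
    have f1 : (x - a) * (b - d) = 0 := by linarith
    have f2 : (c - a) * (d - x) = 0 := by linarith
    rcases mul_eq_zero.1 f1 with f1 | f1 <;> rcases mul_eq_zero.1 f2 with f2 | f2
    · exact ⟨Or.inl (by linarith), Or.inl (by linarith)⟩
    · exact ⟨Or.inl (by linarith), Or.inr (by linarith)⟩
    · exact absurd ⟨by linarith, by linarith⟩ hne
    · exact ⟨Or.inr (by linarith), Or.inr (by linarith)⟩
  rcases le_total a c with hac | hac <;> rcases le_total d b with hdb | hdb
  · exact key ha hb hc hd hne hac hdb hy
  · rcases hac.eq_or_lt with rfl | hac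
    · exact (key hc hd ha hb (fun h => hne ⟨h.1.symm, h.2.symm⟩) le_rfl hdb hy.symm).symm
    · rcases hdb.eq_or_lt with rfl | hdb
      · exact key ha hb hc hd hne hac.le le_rfl hy
      · have : b ≤ c := by
          by_contra hcb
          exact h1 ⟨hac, not_le.1 hcb, hdb⟩
        exact ⟨Or.inr (by linarith), Or.inl (by linarith)⟩
  · rcases hac.eq_or_lt with rfl | hac
    · exact key ha hb hc hd hne le_rfl hdb hy
    · rcases hdb.eq_or_lt with rfl | hdb
      · exact (key hc hd ha hb (fun h => hne ⟨h.1.symm, h.2.symm⟩) hac.le le_rfl hy.symm).symm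
      · have : d ≤ a := by
          by_contra hcb
          exact h2 ⟨hac, not_le.1 hcb, hdb⟩
        exact ⟨Or.inl (by linarith), Or.inr (by linarith)⟩
  · exact (key hc hd ha hb (fun h => hne ⟨h.1.symm, h.2.symm⟩) hac hdb hy.symm).symm

/-- A graph with a two-page book embedding is planar: the vertices are put on a line by `x`, and
the edges are assigned to two pages by `page` such that no two edges of a page cross. -/
theorem SimpleGraph.isPlanar_of_twoPage {V : Type*} (G : SimpleGraph V) (x : V → ℝ)
    (hx : Function.Injective x) (page : V → V → Prop)
    (hpage : ∀ a b c d, G.Adj a b → G.Adj c d → (page a b ↔ page c d) →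
      x a < x c → x c < x b → x b < x d → False) : G.IsPlanar := by
  classical
  have hends : ∀ e : G.edgeSet, ∃ q : V × V, (e : Sym2 V) = s(q.1, q.2) ∧ x q.1 < x q.2 := by
    rintro ⟨e, he⟩
    induction e with
    | _ a b =>
      have hab : x a ≠ x b := fun h => (G.ne_of_adj he) (hx h)
      rcases hab.lt_or_gt with h | h
      · exact ⟨(a, b), rfl, h⟩
      · exact ⟨(b, a), Sym2.eq_swap, h⟩
  choose q hq hlt using hends
  have hadj : ∀ e, G.Adj (q e).1 (q e).2 := fun e => by
    have := e.2
    rwa [hq e] at this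
  let sgn : G.edgeSet → ℝ := fun e => if page (q e).1 (q e).2 then 1 else -1
  have hsgn : ∀ e, sgn e ≠ 0 := fun e => by
    by_cases h : page (q e).1 (q e).2 <;> simp [sgn, h]
  refine ⟨fun v => !₂[x v, 0],
    fun e => ⟨fun t => parabolaPoint (sgn e) (x (q e).1) (x (q e).2) t,
      (continuous_parabolaPoint _ _ _).comp continuous_subtype_val⟩, ?_, ?_, ?_, ?_, ?_⟩
  · intro u v h
    exact hx (euclidean_pair_inj.1 h).1
  · intro e t t' h
    have h1 := (euclidean_pair_inj.1 h).1
    have h2 : (t : ℝ) * (x (q e).2 - x (q e).1) = t' * (x (q e).2 - x (q e).1) := by linarith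
    exact Subtype.ext (mul_right_cancel₀ (sub_pos.2 (hlt e)).ne' h2)
  · intro e
    exact ⟨_, _, hq e, by simp, by simp⟩
  · rintro e v ⟨t, ht⟩
    obtain ⟨h1, h2⟩ := euclidean_pair_inj.1 ht
    have hpos := sub_pos.2 (hlt e)
    rw [hq e, Sym2.mem_iff]
    have : (t : ℝ) = 0 ∨ 1 - (t : ℝ) = 0 := by
      rcases mul_eq_zero.1 h2 with h | h
      · exact absurd h (hsgn e)
      · rcases mul_eq_zero.1 h with h | h <;> rcases mul_eq_zero.1 h with h | h
        · exact Or.inl h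
        · exact absurd h hpos.ne'
        · exact Or.inr h
        · exact absurd h hpos.ne'
    rcases this with h | h
    · left; apply hx; rw [← h1, h]; ring
    · right; apply hx; rw [← h1, show (t : ℝ) = 1 by linarith]; ring
  · rintro e f hef y ⟨⟨t, rfl⟩, ⟨t', ht'⟩⟩
    obtain ⟨h1, h2⟩ := euclidean_pair_inj.1 ht'
    have hpe := sub_pos.2 (hlt e)
    have hpf := sub_pos.2 (hlt f)
    set z := x (q e).1 + t * (x (q e).2 - x (q e).1) with hz
    have hze : z ∈ Set.Icc (x (q e).1) (x (q e).2) :=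
      ⟨by nlinarith [t.2.1], by nlinarith [t.2.2]⟩
    have hzf : z ∈ Set.Icc (x (q f).1) (x (q f).2) :=
      ⟨by nlinarith [t'.2.1], by nlinarith [t'.2.2]⟩
    have he1 : (t : ℝ) * (x (q e).2 - x (q e).1) = z - x (q e).1 := by rw [hz]; ring
    have he2 : (1 - (t : ℝ)) * (x (q e).2 - x (q e).1) = x (q e).2 - z := by rw [hz]; ring
    have hf1 : (t' : ℝ) * (x (q f).2 - x (q f).1) = z - x (q f).1 := by linarith
    have hf2 : (1 - (t' : ℝ)) * (x (q f).2 - x (q f).1) = x (q f).2 - z := by linarith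
    rw [he1, he2, hf1, hf2] at h2
    have hne : ¬(x (q e).1 = x (q f).1 ∧ x (q e).2 = x (q f).2) := fun h => by
      refine hef (Subtype.ext ?_)
      rw [hq e, hq f, hx h.1, hx h.2]
    have hmain : (z = x (q e).1 ∨ z = x (q e).2) ∧ (z = x (q f).1 ∨ z = x (q f).2) := by
      by_cases hp : page (q e).1 (q e).2 ↔ page (q f).1 (q f).2
      · have hs : sgn e = sgn f := by simp [sgn, hp]
        rw [hs] at h2
        refine parabola_meet hze hzf hne ?_ ?_ (mul_left_cancel₀ (hsgn f) h2.symm)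
        · rintro ⟨ha, hb, hc⟩
          exact hpage _ _ _ _ (hadj e) (hadj f) hp ha hb hc
        · rintro ⟨ha, hb, hc⟩
          exact hpage _ _ _ _ (hadj f) (hadj e) hp.symm ha hb hc
      -- On different pages the heights have opposite signs, so both vanish at a common point.
      · have hs : sgn e = -sgn f := by
          by_cases g1 : page (q e).1 (q e).2 <;> by_cases g2 : page (q f).1 (q f).2
          · exact absurd (iff_of_true g1 g2) hp
          · simp only [sgn, if_pos g1, if_neg g2, neg_neg]
          · simp only [sgn, if_neg g1, if_pos g2]
          · exact absurd (iff_of_false g1 g2) hp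
        rw [hs] at h2
        have e1 := mul_nonneg (sub_nonneg.2 hze.1) (sub_nonneg.2 hze.2)
        have e2 := mul_nonneg (sub_nonneg.2 hzf.1) (sub_nonneg.2 hzf.2)
        have e3 : sgn f * ((z - x (q e).1) * (x (q e).2 - z) +
          (z - x (q f).1) * (x (q f).2 - z)) = 0 := by linarith
        have e4 := (mul_eq_zero.1 e3).resolve_left (hsgn f)
        have e5 : (z - x (q e).1) * (x (q e).2 - z) = 0 := by linarith
        have e6 : (z - x (q f).1) * (x (q f).2 - z) = 0 := by linarith
        constructor
        · exact (mul_eq_zero.1 e5).imp sub_eq_zero.1 fun h => (sub_eq_zero.1 h).symm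
        · exact (mul_eq_zero.1 e6).imp sub_eq_zero.1 fun h => (sub_eq_zero.1 h).symm
    have hy : (z - x (q e).1) * (x (q e).2 - z) = 0 := by
      rcases hmain.1 with h | h <;> rw [h] <;> ring
    obtain ⟨⟨v, hv, hzv⟩, ⟨v', hv', hzv'⟩⟩ :
        (∃ v ∈ (e : Sym2 V), z = x v) ∧ (∃ v ∈ (f : Sym2 V), z = x v) := by
      rw [hq e, hq f]
      constructor
      · rcases hmain.1 with h | h
        · exact ⟨_, Sym2.mem_mk_left _ _, h⟩
        · exact ⟨_, Sym2.mem_mk_right _ _, h⟩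
      · rcases hmain.2 with h | h
        · exact ⟨_, Sym2.mem_mk_left _ _, h⟩
        · exact ⟨_, Sym2.mem_mk_right _ _, h⟩
    obtain rfl : v = v' := hx (hzv.symm.trans hzv')
    refine ⟨v, hv, hv', ?_⟩
    refine euclidean_pair_inj.2 ⟨hzv, ?_⟩
    rw [he1, he2, hy, mul_zero]

namespace Digraph

/-! ### The tower and its book embedding -/

/-- The tower of directed cycles: level `k ≤ N` is a directed path `(k, 0) → ⋯ → (k, h + 1)`; the
last vertex of level `k + 1` dominates both ends of level `k`, and these dominate the first vertex
of level `k + 1`. -/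
def cycleTower (N h : ℕ) : Digraph (Fin (N + 1) × Fin (h + 2)) where
  Adj a b :=
    ((a.1 : ℕ) = b.1 ∧ (a.2 : ℕ) + 1 = b.2) ∨
    ((a.1 : ℕ) = b.1 + 1 ∧ (a.2 : ℕ) = h + 1 ∧ ((b.2 : ℕ) = 0 ∨ (b.2 : ℕ) = h + 1)) ∨
    ((a.1 : ℕ) + 1 = b.1 ∧ (b.2 : ℕ) = 0 ∧ ((a.2 : ℕ) = 0 ∨ (a.2 : ℕ) = h + 1))

/-- The position of a vertex of the tower on the spine of the book. -/
noncomputable def towerPos (N h : ℕ) (a : Fin (N + 1) × Fin (h + 2)) : ℝ :=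
  if (a.2 : ℕ) = h + 1 then -((a.1 : ℕ) + 1 : ℝ) else ((a.1 : ℕ) : ℝ) + 1 - (a.2 : ℕ) / (h + 1)

/-- Moves the spine order into natural numbers, so that `omega` can check crossings. From left to
right come the last vertices by descending level, then the rest by ascending level, each path
reversed. -/
theorem towerPos_lt_iff {N h : ℕ} (a b : Fin (N + 1) × Fin (h + 2)) :
    towerPos N h a < towerPos N h b ↔
      ((a.2 : ℕ) = h + 1 ∧ ((b.2 : ℕ) ≠ h + 1 ∨ (b.1 : ℕ) < a.1)) ∨
      ((a.2 : ℕ) ≠ h + 1 ∧ (b.2 : ℕ) ≠ h + 1 ∧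
        ((a.1 : ℕ) < b.1 ∨ ((a.1 : ℕ) = b.1 ∧ (b.2 : ℕ) < a.2))) := by
  have hh : (0 : ℝ) < h + 1 := by positivity
  have frac : ∀ j : Fin (h + 2), (j : ℕ) ≠ h + 1 → 0 ≤ ((j : ℕ) : ℝ) / (h + 1) ∧
      ((j : ℕ) : ℝ) / (h + 1) < 1 := fun j hj => by
    refine ⟨by positivity, (div_lt_one hh).2 ?_⟩
    have : (j : ℕ) < h + 1 := by omega
    exact_mod_cast this
  have ha0 : (0 : ℝ) ≤ (a.1 : ℕ) := Nat.cast_nonneg _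
  have hb0 : (0 : ℝ) ≤ (b.1 : ℕ) := Nat.cast_nonneg _
  unfold towerPos
  by_cases ha : (a.2 : ℕ) = h + 1 <;> by_cases hb : (b.2 : ℕ) = h + 1
  · rw [if_pos ha, if_pos hb, neg_lt_neg_iff, add_lt_add_iff_right, Nat.cast_lt]
    omega
  · have := frac _ hb
    rw [if_pos ha, if_neg hb]
    exact iff_of_true (by linarith) (by omega)
  · have := frac _ ha
    rw [if_neg ha, if_pos hb]
    exact iff_of_false (by linarith) (by omega)
  · have h1 := frac _ ha
    have h2 := frac _ hb
    rw [if_neg ha, if_neg hb]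
    rcases lt_trichotomy (a.1 : ℕ) b.1 with hl | hl | hl
    · have : ((a.1 : ℕ) : ℝ) + 1 ≤ (b.1 : ℕ) := by exact_mod_cast hl
      exact iff_of_true (by linarith) (by omega)
    · rw [hl, sub_lt_sub_iff_left, div_lt_div_iff_of_pos_right hh, Nat.cast_lt]
      omega
    · have : ((b.1 : ℕ) : ℝ) + 1 ≤ (a.1 : ℕ) := by exact_mod_cast hl
      exact iff_of_false (by linarith) (by omega)

theorem towerPos_injective (N h : ℕ) : Function.Injective (towerPos N h) := by
  intro a b hab
  have h1 := mt (towerPos_lt_iff a b).2 hab.not_lt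
  have h2 := mt (towerPos_lt_iff b a).2 hab.not_gt
  have ha := a.2.2
  have hb := b.2.2
  refine Prod.ext (Fin.ext ?_) (Fin.ext ?_) <;> omega

/-- The edges of the tower, read from left to right on the spine. -/
theorem cycleTower_adj_of_lt {N h : ℕ} {a b : Fin (N + 1) × Fin (h + 2)}
    (hab : (cycleTower N h).toSimpleGraphInclusive.Adj a b)
    (hlt : towerPos N h a < towerPos N h b) :
    ((a.2 : ℕ) = h + 1 ∧ (b.1 : ℕ) = a.1 ∧ (b.2 : ℕ) = h) ∨
    ((a.2 : ℕ) = h + 1 ∧ (b.2 : ℕ) = h + 1 ∧ (a.1 : ℕ) = b.1 + 1) ∨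
    ((a.2 : ℕ) = h + 1 ∧ (b.2 : ℕ) = 0 ∧ (a.1 : ℕ) = b.1 + 1) ∨
    ((a.1 : ℕ) = b.1 ∧ (a.2 : ℕ) = b.2 + 1 ∧ (a.2 : ℕ) ≠ h + 1) ∨
    ((a.2 : ℕ) = h + 1 ∧ (b.2 : ℕ) = 0 ∧ (a.1 : ℕ) + 1 = b.1) ∨
    ((a.2 : ℕ) = 0 ∧ (b.2 : ℕ) = 0 ∧ (a.1 : ℕ) + 1 = b.1) := by
  rw [towerPos_lt_iff] at hlt
  have ha := a.2.2
  have hb := b.2.2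
  obtain ⟨-, h1 | h1⟩ := hab <;> rcases h1 with h1 | h1 | h1 <;> omega

/-- On either page the edges from a last vertex to the positive side are nested. The other edges
join spine neighbours or first vertices of consecutive levels, and no nested edge ends strictly
beneath them. -/
theorem cycleTower_isPlanar (N h : ℕ) : (cycleTower N h).IsPlanar := by
  refine SimpleGraph.isPlanar_of_twoPage _ (towerPos N h) (towerPos_injective N h)
    (fun a b => (b.2 : ℕ) = 0 ∧ (a.1 : ℕ) < b.1) ?_
  intro a b c d hab hcd hp h1 h2 h3
  have e1 := cycleTower_adj_of_lt hab (h1.trans h2)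
  have e2 := cycleTower_adj_of_lt hcd (h2.trans h3)
  rw [towerPos_lt_iff] at h1 h2 h3
  rcases e1 with e1 | e1 | e1 | e1 | e1 | e1 <;> rcases e2 with e2 | e2 | e2 | e2 | e2 | e2 <;>
    omega

/-! ### Directed cycles of the tower -/

/-- Take `m` to be the highest level met. With no arc to or from level `m + 1`, the cycle can enter
level `m` only at its first vertex and leave only at its last, so it traverses the whole path. -/
theorem exists_level_of_isDirectedCycle {N h n : ℕ} {c : ZMod n → Fin (N + 1) × Fin (h + 2)}
    (hc : (cycleTower N h).IsDirectedCycle n c) :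
    ∃ m : Fin (N + 1), (∀ j, ∃ i, c i = (m, j)) ∧ ∃ i, (c i).1 ≠ m := by
  obtain ⟨hn, -, hadj⟩ := hc
  have : NeZero n := ⟨by omega⟩
  obtain ⟨i₀, hi₀⟩ := Finite.exists_max fun i => (c i).1
  set m := (c i₀).1 with hm
  have hle : ∀ i, ((c i).1 : ℕ) ≤ m := fun i => hi₀ i
  have fwd : ∀ j (i : ZMod n), ((c i).2 : ℕ) = j → (c i).1 = m → ((c i).2 : ℕ) ≠ h + 1 →
      ((c (i + 1)).2 : ℕ) = j + 1 ∧ (c (i + 1)).1 = m := by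
    intro j i h1 h2 h3
    have h4 : ((c i).1 : ℕ) = m := congrArg Fin.val h2
    have h5 := hle (i + 1)
    have : ((c (i + 1)).2 : ℕ) = j + 1 ∧ ((c (i + 1)).1 : ℕ) = m := by
      rcases hadj i with e | e | e <;> omega
    exact ⟨this.1, Fin.ext this.2⟩
  have bwd : ∀ j (i : ZMod n), ((c i).2 : ℕ) = j + 1 → (c i).1 = m →
      ((c (i - 1)).2 : ℕ) = j ∧ (c (i - 1)).1 = m := by
    intro j i h1 h2
    have h4 : ((c i).1 : ℕ) = m := congrArg Fin.val h2
    have h5 := hle (i - 1)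
    have h6 := hadj (i - 1)
    rw [sub_add_cancel] at h6
    have : ((c (i - 1)).2 : ℕ) = j ∧ ((c (i - 1)).1 : ℕ) = m := by
      rcases h6 with e | e | e <;> omega
    exact ⟨this.1, Fin.ext this.2⟩
  have start : ∀ j (i : ZMod n), ((c i).2 : ℕ) = j → (c i).1 = m →
      ∃ i, ((c i).2 : ℕ) = 0 ∧ (c i).1 = m := by
    intro j
    induction j with
    | zero => exact fun i h1 h2 => ⟨i, h1, h2⟩
    | succ j ih => exact fun i h1 h2 => ih _ (bwd j i h1 h2).1 (bwd j i h1 h2).2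
  have all : ∀ j, j ≤ h + 1 → ∃ i, ((c i).2 : ℕ) = j ∧ (c i).1 = m := by
    intro j
    induction j with
    | zero => exact fun _ => start _ i₀ rfl rfl
    | succ j ih =>
      intro hj
      obtain ⟨i, h1, h2⟩ := ih (by omega)
      exact ⟨i + 1, fwd j i h1 h2 (by omega)⟩
  refine ⟨m, fun j => ?_, ?_⟩
  · obtain ⟨i, h1, h2⟩ := all j (by omega)
    exact ⟨i, Prod.ext h2 (Fin.ext h1)⟩
  · obtain ⟨i, h1, h2⟩ := all (h + 1) le_rfl
    refine ⟨i + 1, fun h3 => ?_⟩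
    have h4 : ((c i).1 : ℕ) = m := congrArg Fin.val h2
    have h5 : ((c (i + 1)).1 : ℕ) = m := congrArg Fin.val h3
    have := (c (i + 1)).2.2
    rcases hadj i with e | e | e <;> omega

/-- The path of level `k`, closed by a vertex `z`. -/
def towerCycle {N h : ℕ} (k : Fin (N + 1)) (z : Fin (N + 1) × Fin (h + 2)) (i : ZMod (h + 3)) :
    Fin (N + 1) × Fin (h + 2) :=
  if hi : i.val < h + 2 then (k, ⟨i.val, hi⟩) else z

theorem towerCycle_isDirectedCycle {N h : ℕ} {k : Fin (N + 1)} {z : Fin (N + 1) × Fin (h + 2)}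
    (hz : (z.1 : ℕ) + 1 = k) (hz2 : (z.2 : ℕ) = 0 ∨ (z.2 : ℕ) = h + 1) :
    (cycleTower N h).IsDirectedCycle (h + 3) (towerCycle k z) := by
  refine ⟨by omega, ?_, ?_⟩
  · intro i i' hii
    have hi := ZMod.val_lt i
    have hi' := ZMod.val_lt i'
    apply ZMod.val_injective
    unfold towerCycle at hii
    split_ifs at hii with h1 h2 h2
    · exact congrArg (fun v => (v.2 : ℕ)) hii
    · have := congrArg (fun v => (v.1 : ℕ)) hii
      simp only at this
      omega
    · have := congrArg (fun v => (v.1 : ℕ)) hii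
      simp only at this
      omega
    · omega
  · intro i
    have hi := ZMod.val_lt i
    have hs : (i + 1).val = if i.val = h + 2 then 0 else i.val + 1 := by
      split_ifs with hh
      · have : i = -1 := by
          apply ZMod.val_injective
          rw [hh, ZMod.val_neg_one]
        rw [this, neg_add_cancel, ZMod.val_zero]
      · have h1 : (1 : ZMod (h + 3)).val = 1 := ZMod.val_one'' (by omega)
        rw [ZMod.val_add_of_lt (by omega), h1]
    unfold towerCycle
    rw [cycleTower]
    rcases eq_or_ne i.val (h + 2) with hv | hv
    · rw [if_pos hv] at hs
      split_ifs <;> simp only [] <;> omega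
    · rw [if_neg hv] at hs
      split_ifs
      · exact Or.inl ⟨rfl, hs.symm⟩
      all_goals simp only []; omega

theorem cycleTower_digirth (N h : ℕ) (hN : 1 ≤ N) :
    (cycleTower N h).digirth = ((h + 3 : ℕ) : ℕ∞) := by
  apply le_antisymm
  · exact iInf₂_le (h + 3) ⟨_, towerCycle_isDirectedCycle (k := ⟨1, by omega⟩)
      (z := (⟨0, by omega⟩, 0)) rfl (Or.inl rfl)⟩
  · refine le_iInf₂ fun n ⟨c, hc⟩ => ?_
    obtain ⟨m, hm, i, hi⟩ := exists_level_of_isDirectedCycle hc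
    have : NeZero n := ⟨by have := hc.1; omega⟩
    choose f hf using hm
    -- The `h + 2` vertices of the level and one vertex off it occupy distinct places on the cycle.
    let F : Option (Fin (h + 2)) → ZMod n := fun o => o.elim i f
    have hF : Function.Injective F := by
      rintro (_ | j) (_ | j') hjj
      · rfl
      · exact absurd (by rw [show i = f j' from hjj, hf]) hi
      · exact absurd (by rw [show i = f j from hjj.symm, hf]) hi
      · have : c (f j) = c (f j') := congrArg c hjj
        rw [hf, hf] at this
        exact congrArg some (Prod.ext_iff.1 this).2
    have := Fintype.card_le_of_injective F hF
    rw [Fintype.card_option, Fintype.card_fin, ZMod.card] at this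
    exact_mod_cast this

/-! ### Lower bound: covering the circle by arcs -/

open MeasureTheory

/-- In an acyclic `p`-colouring, every directed cycle has, for every point `q` of the circle, a
vertex whose colour is followed by `q` within distance `p - 1`. -/
theorem IsAcyclicColouring.exists_mem_closedBall {V : Type*} {D : Digraph V} {p : ℝ} (hp : 1 ≤ p)
    {c : V → AddCircle p} (hc : D.IsAcyclicColouring p c) {n : ℕ} {f : ZMod n → V}
    (hf : D.IsDirectedCycle n f) (q : AddCircle p) :
    ∃ i, q ∈ Metric.closedBall (c (f i) + (((p - 1) / 2 : ℝ) : AddCircle p)) ((p - 1) / 2) := by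
  have hp0 : 0 < p := by linarith
  have : Fact (0 < p) := ⟨hp0⟩
  by_contra! hcon
  obtain ⟨a, rfl⟩ := QuotientAddGroup.mk_surjective q
  refine hc a ⟨n, f, hf, fun i => ?_⟩
  have hi := hcon i
  obtain ⟨r, ⟨hr1, hr2⟩, hr⟩ := (AddCircle.coe_image_Icc_eq p (-(p / 2))).ge
    (Set.mem_univ ((a : AddCircle p) - (c (f i) + (((p - 1) / 2 : ℝ) : AddCircle p))))
  have hr : (r : AddCircle p) = a - (c (f i) + (((p - 1) / 2 : ℝ) : AddCircle p)) := hr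
  have hnorm : (p - 1) / 2 < |r| := by
    rw [Metric.mem_closedBall, not_le, dist_eq_norm] at hi
    have e : ‖(r : AddCircle p)‖ = |r| := by
      rw [AddCircle.norm_coe_eq_abs_iff _ hp0.ne', abs_of_pos hp0, abs_le]
      constructor <;> linarith
    rw [← e, hr]
    exact hi
  have hcol : c (f i) = ((a - (p - 1) / 2 - r : ℝ) : AddCircle p) := by
    rw [AddCircle.coe_sub, AddCircle.coe_sub, hr]
    abel
  rcases lt_abs.1 hnorm with hlt | hlt
  · refine ⟨a - (p - 1) / 2 - r + p, ⟨by linarith, by linarith⟩, ?_⟩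
    simp only []
    rw [hcol, AddCircle.coe_add_period]
  · exact ⟨a - (p - 1) / 2 - r, ⟨by linarith, by linarith⟩, hcol.symm⟩

/-- If `S` together with either of `A` and `A'` covers the space, then the overlap of `A` and `A'`
is large, that is, their union is small. -/
theorem measureReal_union_le_of_cover {α : Type*} [MeasurableSpace α] (μ : Measure α)
    [IsFiniteMeasure μ] {S A A' : Set α} (hA' : MeasurableSet A')
    (h : S ∪ A = Set.univ) (h' : S ∪ A' = Set.univ) :
    μ.real (A ∪ A') + μ.real Set.univ ≤ μ.real A + μ.real A' + μ.real S := by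
  have h1 := measureReal_union_add_inter (μ := μ) (s := A) hA'
  have h2 : μ.real Set.univ ≤ μ.real (S ∪ (A ∩ A')) :=
    measureReal_mono (by rw [Set.union_inter_distrib_left, h, h', Set.univ_inter])
  have h3 := measureReal_union_le (μ := μ) S (A ∩ A')
  linarith

theorem IsAcyclicColouring.cycleTower_bound {N h : ℕ} {p : ℝ} (hp : 1 ≤ p)
    {c : Fin (N + 1) × Fin (h + 2) → AddCircle p}
    (hc : (cycleTower N h).IsAcyclicColouring p c) :
    N * (1 - (h + 1) * (p - 1)) ≤ 2 * (p - 1) := by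
  have hp0 : 0 < p := by linarith
  have : Fact (0 < p) := ⟨hp0⟩
  let μ : Measure (AddCircle p) := volume
  let A : Fin (N + 1) × Fin (h + 2) → Set (AddCircle p) := fun v =>
    Metric.closedBall (c v + (((p - 1) / 2 : ℝ) : AddCircle p)) ((p - 1) / 2)
  have hAm : ∀ v, MeasurableSet (A v) := fun v => Metric.isClosed_closedBall.measurableSet
  have hA : ∀ v, μ.real (A v) ≤ p - 1 := fun v => by
    simp only [A, μ, measureReal_def, AddCircle.volume_closedBall]
    rw [ENNReal.toReal_ofReal (le_min hp0.le (by linarith))]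
    exact (min_le_right _ _).trans (by linarith)
  have huniv : μ.real Set.univ = p := by
    simp only [μ, measureReal_def, AddCircle.measure_univ]
    exact ENNReal.toReal_ofReal hp0.le
  let S : Fin (N + 1) → Set (AddCircle p) := fun k => ⋃ j, A (k, j)
  have hcover : ∀ k z : Fin (N + 1), ∀ j : Fin (h + 2), (z : ℕ) + 1 = k →
      ((j : ℕ) = 0 ∨ (j : ℕ) = h + 1) → S k ∪ A (z, j) = Set.univ := by
    intro k z j hz hj
    refine Set.eq_univ_of_forall fun q => ?_
    obtain ⟨i, hi⟩ := hc.exists_mem_closedBall hp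
      (towerCycle_isDirectedCycle (k := k) (z := (z, j)) hz hj) q
    unfold towerCycle at hi
    split_ifs at hi with hlt
    · exact Or.inl (Set.mem_iUnion.2 ⟨_, hi⟩)
    · exact Or.inr hi
  -- Inner vertices are charged `p - 1` each; the two end arcs stay together, since it is their
  -- union that the recursion tracks.
  have hS : ∀ k, μ.real (S k) ≤ h * (p - 1) + μ.real (A (k, 0) ∪ A (k, Fin.last _)) := by
    intro k
    have hsub : S k ⊆ (⋃ j : Fin h, A (k, j.castSucc.succ)) ∪
        (A (k, 0) ∪ A (k, Fin.last _)) := by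
      refine Set.iUnion_subset fun j => ?_
      induction j using Fin.cases with
      | zero => exact Set.subset_union_left.trans Set.subset_union_right
      | succ j =>
        induction j using Fin.lastCases with
        | last => exact Set.subset_union_right.trans Set.subset_union_right
        | cast j =>
          exact (Set.subset_iUnion (fun j : Fin h => A (k, j.castSucc.succ)) j).trans
            Set.subset_union_left
    have h1 := (measureReal_mono (μ := μ) hsub).trans (measureReal_union_le _ _)
    have h2 := measureReal_iUnion_fintype_le (μ := μ) fun j : Fin h => A (k, j.castSucc.succ)
    have h3 := Finset.sum_le_sum fun (j : Fin h) (_ : j ∈ Finset.univ) => hA (k, j.castSucc.succ)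
    rw [Finset.sum_const, Finset.card_univ, Fintype.card_fin, nsmul_eq_mul] at h3
    linarith
  -- Descent from the top level `N`: the gain per level is `p - (h + 2) * (p - 1) = 1 - (h + 1) * (p
  -- - 1)`.
  have hind : ∀ n : ℕ, ∀ k : Fin (N + 1), (k : ℕ) + n = N →
      μ.real (A (k, 0) ∪ A (k, Fin.last _)) ≤ 2 * (p - 1) - n * (1 - (h + 1) * (p - 1)) := by
    intro n
    induction n with
    | zero =>
      intro k _
      have h1 := measureReal_union_le (μ := μ) (A (k, 0)) (A (k, Fin.last _))
      have h2 := hA (k, 0)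
      have h3 := hA (k, Fin.last _)
      push_cast
      linarith
    | succ n ih =>
      intro k hk
      have h1 := ih ⟨k + 1, by omega⟩ (by simp only []; omega)
      have h2 := hS ⟨k + 1, by omega⟩
      have h3 := measureReal_union_le_of_cover μ (hAm (k, Fin.last _))
        (hcover ⟨k + 1, by omega⟩ k 0 rfl (Or.inl rfl))
        (hcover ⟨k + 1, by omega⟩ k (Fin.last _) rfl (Or.inr rfl))
      have h4 := hA (k, 0)
      have h5 := hA (k, Fin.last _)
      rw [huniv] at h3
      push_cast
      linarith
  have h1 := hind N 0 (by simp)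
  have h2 : 0 ≤ μ.real (A (0, 0) ∪ A (0, Fin.last _)) := measureReal_nonneg
  linarith

/-! ### Upper bound and conclusion -/

/-- The complement of an open unit interval is a closed arc of length `1 / (h + 1)`, the spacing of
the colours, so it contains a colour. That colour occurs on every level, hence on every directed
cycle. -/
theorem cycleTower_isAcyclicColouring (N h : ℕ) :
    (cycleTower N h).IsAcyclicColouring (((h : ℝ) + 2) / (h + 1))
      fun v => (((v.2 : ℕ) / ((h : ℝ) + 1) : ℝ) : AddCircle (((h : ℝ) + 2) / (h + 1))) := by
  rintro a ⟨n, c, hc, hmem⟩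
  obtain ⟨m, hm, -⟩ := exists_level_of_isDirectedCycle hc
  have hh : (0 : ℝ) < h + 1 := by positivity
  -- the least integer `z` with `a + 1 ≤ z / (h + 1)`
  set z : ℤ := ⌈(a + 1) * (h + 1)⌉ with hz
  have hz1 : (a + 1) * (h + 1) ≤ z := Int.le_ceil _
  have hz2 : (z : ℝ) < (a + 1) * (h + 1) + 1 := Int.ceil_lt_add_one _
  have hpos : (0 : ℤ) < h + 2 := by positivity
  have hr0 := Int.emod_nonneg z hpos.ne'
  have hr1 := Int.emod_lt_of_pos z hpos
  -- The point `z / (h + 1)` lies in `[a + 1, a + p)`, outside the interval modulo `p`; the vertex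
  -- with index `r = z % (h + 2)` has this colour.
  obtain ⟨r, hr⟩ := Int.eq_ofNat_of_zero_le hr0
  obtain ⟨i, hi⟩ := hm ⟨r, by omega⟩
  obtain ⟨t, ⟨ht1, ht2⟩, ht⟩ := hmem i
  simp only [hi] at ht
  obtain ⟨k, hk⟩ := AddCircle.coe_eq_zero_iff _ |>.1
    (show ((t - r / ((h : ℝ) + 1) : ℝ) : AddCircle (((h : ℝ) + 2) / (h + 1))) = 0 by
      rw [AddCircle.coe_sub, ht, sub_self])
  rw [zsmul_eq_mul] at hk
  -- So `t * (h + 1)` is an integer congruent to `z` modulo `h + 2`, yet lies strictly between `z -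
  -- (h + 2)` and `z`.
  have hw : t * (h + 1) = ((r + k * (h + 2) : ℤ) : ℝ) := by
    have : t = k * ((h + 2) / (h + 1)) + r / (h + 1) := by linarith
    rw [this]
    push_cast
    field_simp
    ring
  have hlt1 : ((r + k * (h + 2) : ℤ) : ℝ) < z := by
    rw [← hw]
    exact (mul_lt_mul_of_pos_right ht2 hh).trans_le hz1
  have hlt2 : (z : ℝ) < ((r + k * (h + 2) + (h + 2) : ℤ) : ℝ) := by
    have := mul_lt_mul_of_pos_right ht1 hh
    have e : ((r + k * (h + 2) + (h + 2) : ℤ) : ℝ) = t * (h + 1) + (h + 2) := by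
      rw [hw]
      push_cast
      ring
    rw [e]
    linarith
  rw [Int.cast_lt] at hlt1 hlt2
  have hdiv := Int.mul_ediv_add_emod z (h + 2)
  rw [hr] at hdiv
  have h1 : k < z / (h + 2) := by
    refine lt_of_mul_lt_mul_right (a := (h + 2 : ℤ)) ?_ hpos.le
    linarith
  have h2 : z / (h + 2) < k + 1 := by
    refine lt_of_mul_lt_mul_right (a := (h + 2 : ℤ)) ?_ hpos.le
    linarith
  omega

end Digraph

theorem mainTheorem10 (g : ℕ) (hg : 3 ≤ g) (ε : ℝ) (hε : 0 < ε) :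
    ∃ (V : Type) (_ : Finite V) (D : Digraph V),
      D.IsPlanar ∧ D.digirth = g ∧
      D.starDichromaticNumber ∈
        Set.Icc ((((g : ℝ) - 1) / ((g : ℝ) - 2) - ε : ℝ) : EReal)
          ((((g : ℝ) - 1) / ((g : ℝ) - 2) : ℝ) : EReal) := by
  obtain ⟨h, rfl⟩ := Nat.exists_eq_add_of_le' hg
  have hh : (0 : ℝ) < h + 1 := by positivity
  have e1 : ((h + 3 : ℕ) : ℝ) - 1 = h + 2 := by push_cast; ring
  have e2 : ((h + 3 : ℕ) : ℝ) - 2 = h + 1 := by push_cast; ring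
  rw [e1, e2]
  -- If `p` were below the claimed bound, `cycleTower_bound` would give `N * ε ≤ 2 * (p - 1) ≤ 2`.
  obtain ⟨N, hN⟩ := exists_nat_gt (2 / ε)
  have hN1 : 1 ≤ N := by
    by_contra hcon
    have : N = 0 := by omega
    subst this
    have : 0 < 2 / ε := by positivity
    simp at hN
    linarith
  have hfrac : ((h : ℝ) + 2) / (h + 1) = 1 + 1 / (h + 1) := by field_simp; ring
  have hinv : 1 / ((h : ℝ) + 1) ≤ 1 := (div_le_one hh).2 (by linarith [Nat.cast_nonneg (α := ℝ) h])
  refine ⟨_, inferInstance, Digraph.cycleTower N h, Digraph.cycleTower_isPlanar N h,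
    Digraph.cycleTower_digirth N h hN1, ?_, ?_⟩
  · refine le_iInf₂ fun p ⟨hp, c, hc⟩ => EReal.coe_le_coe_iff.2 ?_
    by_contra! hlt
    have hb := hc.cycleTower_bound hp
    rw [hfrac] at hlt
    have h1 : (h + 1) * (p - 1) ≤ 1 - (h + 1) * ε := by
      have := mul_le_mul_of_nonneg_left (show p - 1 ≤ 1 / (h + 1) - ε by linarith) hh.le
      rwa [mul_sub _ _ ε, mul_one_div_cancel hh.ne'] at this
    have h2 : ε ≤ (h + 1) * ε := by nlinarith [Nat.cast_nonneg (α := ℝ) h]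
    have h3 : (N : ℝ) * ε ≤ N * (1 - (h + 1) * (p - 1)) :=
      mul_le_mul_of_nonneg_left (by linarith) (Nat.cast_nonneg _)
    have h4 : 2 < N * ε := (div_lt_iff₀ hε).1 hN
    linarith
  · refine iInf₂_le _ ⟨?_, _, Digraph.cycleTower_isAcyclicColouring N h⟩
    rw [hfrac]
    have : 0 ≤ 1 / ((h : ℝ) + 1) := by positivity
    linarith
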